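/- **Theorem.** Let $\Gamma$ be a finite connected $k$-regular graph with $n$ vertices whose adjacency matrix $A$ has exactly four distinct eigenvalues, with spectrum $\{\theta_0^{m_0},\theta_1^{m_1},\theta_2^{m_2},\theta_3^{m_3}\}$, where $\theta_0=k>\theta_1>\theta_2>\theta_3$ and $m_0=1$. Let $p_0,p_1,p_2,p_3$ be the predistance polynomials of $\Gamma$, that is, the polynomials with $\deg p_i=i$ that are orthogonal for $\langle p,q\rangle_\Gamma=\frac1n\operatorname{tr}(p(A)q(A))$ and normalized by $\|p_i\|_\Gamma^2=p_i(k)$, and let $\gamma_2=\langle xp_1,p_2\rangle_\Gamma/\|p_2\|_\Gamma^2$ be the corresponding preintersection number. Let $\overline{k_3}=\frac1n\sum_{u\in V}k_3(u)$, where $k_3(u)$ is the number of vertices at distance $3$ from $u$. Put $$s_1(x)=x^2-(\theta_1+\theta_3)x+\gamma_2+\theta_2(\theta_1-\theta_2+\theta_3),$$ $$s_2(x)=x^2-(\theta_1+\theta_2)x+\gamma_2+\theta_3(\theta_1-\theta_3+\theta_2),$$ $$\tau_j=\frac{s_j(\theta_0)\sum_{i=1}^3 m_is_j(\theta_i)-\sum_{i=1}^3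 m_is_j(\theta_i)^2}{s_j(\theta_0)(n-1)-\sum_{i=1}^3 m_is_j(\theta_i)}\qquad(j=1,2).$$ The denominator of $\tau_1$ is nonzero. For each $j\in\{1,2\}$ such that the denominator of $\tau_j$ is nonzero, $$\overline{k_3}\le\frac{n\sum_{i=1}^3m_i(s_j(\theta_i)-\tau_j)^2}{\sum_{i=0}^3m_i(s_j(\theta_i)-\tau_j)^2}.\qquad(*)$$ Moreover, equality holds in $(*)$ for some $j\in\{1,2\}$ for which $\tau_j$ is defined if and only if $\Gamma$ is distance-regular and its distance-$1$-or-$2$ graph $\Gamma_{1,2}$ (two vertices being adjacent when their distance in $\Gamma$ is $1$ or $2$) is strongly regular. -/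

import Mathlib

open scoped BigOperators Polynomial

noncomputable section

namespace SpectralExcess

section Spectral

variable {V : Type*} [Fintype V] [DecidableEq V] (G : SimpleGraph V) [DecidableRel G.Adj]

/-- `spec G = {θ₀^{m₀}, θ₁^{m₁}, θ₂^{m₂}, θ₃^{m₃}}`: the multiset of eigenvalues of the adjacency
matrix, counted with multiplicity, consists of `m i` copies of `θ i` for each `i`. -/
def HasSpectrum (θ : Fin 4 → ℝ) (m : Fin 4 → ℕ) : Prop :=
  (G.adjMatrix ℝ).charpoly.roots = ∑ i, Multiset.replicate (m i) (θ i)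

/-- The scalar product `⟨p, q⟩ = (1/n) tr (p(A) q(A))` on real polynomials, where `A` is the
adjacency matrix of `G` and `n` its number of vertices. -/
def polyInner (p q : ℝ[X]) : ℝ :=
  1 / (Fintype.card V : ℝ) *
    Matrix.trace (Polynomial.aeval (G.adjMatrix ℝ) p * Polynomial.aeval (G.adjMatrix ℝ) q)

/-- The monic orthogonal polynomials of `polyInner`: the Gram-Schmidt process applied to
`1, x, x², …`. -/
def monicOrth (i : ℕ) : ℝ[X] :=
  Polynomial.X ^ i - ∑ j : Fin i,
    Polynomial.C (polyInner G (Polynomial.X ^ i) (monicOrth j) /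
      polyInner G (monicOrth j) (monicOrth j)) * monicOrth j
termination_by i
decreasing_by all_goals exact j.isLt

/-- The predistance polynomials of a `k`-regular graph: the orthogonal polynomials `pᵢ` of degree
`i`, scaled so that `‖pᵢ‖² = pᵢ(k)`. -/
def predistancePoly (k : ℕ) (i : ℕ) : ℝ[X] :=
  Polynomial.C ((monicOrth G i).eval (k : ℝ) / polyInner G (monicOrth G i) (monicOrth G i)) *
    monicOrth G i

/-- The preintersection number `γ_{i+1}`: the Fourier coefficient of `x pᵢ` with respect to
`p_{i+1}`. So `γ₂` is `preGammaSucc G k 1`. -/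
def preGammaSucc (k : ℕ) (i : ℕ) : ℝ :=
  polyInner G (Polynomial.X * predistancePoly G k i) (predistancePoly G k (i + 1)) /
    polyInner G (predistancePoly G k (i + 1)) (predistancePoly G k (i + 1))

end Spectral

section Distance

variable {V : Type*} [Fintype V] (G : SimpleGraph V)

open Classical in
/-- `kᵢ(u)`: the number of vertices at distance `i` from `u`. -/
def numAtDist (i : ℕ) (u : V) : ℕ :=
  (Finset.univ.filter fun v => G.dist u v = i).card

/-- The average of `kᵢ(u)` over all vertices `u`. -/
def avgAtDist (i : ℕ) : ℝ :=
  1 / (Fintype.card V : ℝ) * ∑ u, (numAtDist G i u : ℝ)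

open Classical in
/-- A graph is distance-regular if it is connected and, for vertices `u, v` at distance `i`, the
number of neighbours of `v` at distance `i + 1` from `u`, and the number of neighbours of `v` at
distance `i - 1` from `u`, depend only on `i`. -/
def IsDistanceRegular : Prop :=
  G.Connected ∧ ∃ b c : ℕ → ℕ, ∀ u v : V,
    (Finset.univ.filter fun w => G.Adj v w ∧ G.dist u w = G.dist u v + 1).card =
      b (G.dist u v) ∧
    (Finset.univ.filter fun w => G.Adj v w ∧ G.dist u w + 1 = G.dist u v).card =
      c (G.dist u v)

/-- The distance-1-or-2 graph: same vertices, adjacent when at distance 1 or 2 in `G`. -/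
def distOneOrTwoGraph : SimpleGraph V where
  Adj u v := G.dist u v = 1 ∨ G.dist u v = 2
  symm := ⟨fun u v h => by rwa [G.dist_comm]⟩
  loopless := ⟨fun u h => by simp at h⟩

open Classical in
/-- Strongly regular, for some parameters; complete and empty graphs are excluded. -/
def IsStronglyRegular : Prop :=
  G ≠ ⊥ ∧ G ≠ ⊤ ∧ ∃ n k l μ : ℕ, G.IsSRGWith n k l μ

end Distance

section Quadratics

variable (θ : Fin 4 → ℝ) (m : Fin 4 → ℕ)

/-- `s₁(x) = x² - (θ₁ + θ₃) x + γ₂ + θ₂ (θ₁ - θ₂ + θ₃)`. -/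
def s₁ (γ₂ : ℝ) : ℝ[X] :=
  Polynomial.X ^ 2 - Polynomial.C (θ 1 + θ 3) * Polynomial.X +
    Polynomial.C (γ₂ + θ 2 * (θ 1 - θ 2 + θ 3))

/-- `s₂(x) = x² - (θ₁ + θ₂) x + γ₂ + θ₃ (θ₁ - θ₃ + θ₂)`. -/
def s₂ (γ₂ : ℝ) : ℝ[X] :=
  Polynomial.X ^ 2 - Polynomial.C (θ 1 + θ 2) * Polynomial.X +
    Polynomial.C (γ₂ + θ 3 * (θ 1 - θ 3 + θ 2))

/-- The denominator `s(θ₀)(n - 1) - ∑_{i=1}^3 mᵢ s(θᵢ)` of `τ`. -/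
def tauDen (n : ℕ) (s : ℝ[X]) : ℝ :=
  s.eval (θ 0) * ((n : ℝ) - 1) - ∑ i ∈ {1, 2, 3}, (m i : ℝ) * s.eval (θ i)

/-- `τ = (s(θ₀) ∑_{i=1}^3 mᵢ s(θᵢ) - ∑_{i=1}^3 mᵢ s(θᵢ)²) / (s(θ₀)(n - 1) - ∑_{i=1}^3 mᵢ s(θᵢ))`. -/
def tau (n : ℕ) (s : ℝ[X]) : ℝ :=
  (s.eval (θ 0) * (∑ i ∈ {1, 2, 3}, (m i : ℝ) * s.eval (θ i)) -
      ∑ i ∈ {1, 2, 3}, (m i : ℝ) * s.eval (θ i) ^ 2) /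
    tauDen θ m n s

/-- `n ∑_{i=1}^3 mᵢ (s(θᵢ) - τ)² / ∑_{i=0}^3 mᵢ (s(θᵢ) - τ)²`. -/
def spectralBound (n : ℕ) (s : ℝ[X]) : ℝ :=
  ((n : ℝ) * ∑ i ∈ {1, 2, 3}, (m i : ℝ) * (s.eval (θ i) - tau θ m n s) ^ 2) /
    ∑ i, (m i : ℝ) * (s.eval (θ i) - tau θ m n s) ^ 2

end Quadratics

end SpectralExcess

end

namespace SpectralExcess

open Polynomial Matrix

/-! Let `N = I + A₁ + A₂` (`nearMatrix`), and let `q = x² - αx + β` be any monic quadratic. The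
matrix `q(A)` is supported on pairs at distance at most `2`, its rows sum to `q(k)`, and its squared
Frobenius norm is `∑ mᵢ q(θᵢ)²`. The diameter is at most `3`, so `N` has squared norm `n (n - k̄₃)`.
Cauchy-Schwarz for `q(A)` and `N` therefore bounds `k̄₃`, with equality iff `q(A) = c N`
(`avgAtDist_le_and_eq_iff`). The inequality (*) is the case `q = sⱼ - τⱼ`.

Suppose `q(A) = c N`. Then `c ≠ 0`. By Hoffman's identity the cubic with roots `θ₁, θ₂, θ₃` sends
`A` to a nonzero multiple of `J`, so `I, A, N, J` span a space closed under multiplication by `A`;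
this is distance-regularity. The linear coefficient of `sⱼ` makes `q` take equal values at `θ₁` and
another `θᵢ`, so `q` has at most two values on the nonprincipal spectrum. Hence `N` satisfies a
quadratic equation modulo `J`, and `Γ₁,₂` is strongly regular.

Conversely, distance-regularity writes `A²` through `I, A, A₂`, giving some `q(A) = c N`. Strong
regularity leaves at most two values for `q` on the nonprincipal spectrum, and a sign argument shows
that they must agree at `θ₁` and `θ₃`, so `α = θ₁ + θ₃` (`eq_add_of_isStronglyRegular`). Thus only
`s₁` can attain equality. The constant term of `s₁`, and with it `γ₂`, plays no role: `τ` follows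
every shift of the constant and lands on the right one (`tau_eq_of_quad_eq`). -/

theorem trace_aeval_of_isHermitian {V : Type*} [Fintype V] [DecidableEq V] {A : Matrix V V ℝ}
    (hA : A.IsHermitian) (p : ℝ[X]) :
    (aeval A p).trace = (A.charpoly.roots.map fun x => p.eval x).sum := by
  rw [hA.roots_charpoly_eq_eigenvalues]
  have hd : ∀ d : V → ℝ, aeval (diagonal d) p = diagonal fun i => p.eval (d i) := by
    intro d
    have := aeval_algHom_apply (Matrix.diagonalAlgHom (n := V) (α := ℝ) ℝ) d p
    simp only [Matrix.diagonalAlgHom_apply] at this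
    rw [this]
    congr 1
    ext i
    have := aeval_algHom_apply (Pi.evalAlgHom ℝ (fun _ : V => ℝ) i) d p
    simp
  conv_lhs => rw [hA.spectral_theorem, aeval_algHom_apply, hd]
  simp only [Unitary.conjStarAlgAut_apply]
  rw [Matrix.trace_mul_comm]
  rw [← Matrix.mul_assoc, Unitary.coe_star_mul_self, Matrix.one_mul, Matrix.trace_diagonal]
  simp

/-! ### Polynomials in the adjacency matrix and Hoffman's identity -/

section

variable {V : Type*} [Fintype V] [DecidableEq V] (G : SimpleGraph V) [DecidableRel G.Adj]

theorem HasSpectrum.trace_aeval {θ : Fin 4 → ℝ} {m : Fin 4 → ℕ} (h : HasSpectrum G θ m)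
    (p : ℝ[X]) :
    (aeval (G.adjMatrix ℝ) p).trace = ∑ i, (m i : ℝ) * p.eval (θ i) := by
  rw [trace_aeval_of_isHermitian (G.isHermitian_adjMatrix ℝ), h]
  simp [Fin.sum_univ_four]

theorem transpose_aeval_adjMatrix (p : ℝ[X]) :
    (aeval (G.adjMatrix ℝ) p)ᵀ = aeval (G.adjMatrix ℝ) p := by
  induction p using Polynomial.induction_on' with
  | add p q hp hq => simp [hp, hq]
  | monomial n a =>
    simp [aeval_monomial, Matrix.transpose_pow, Algebra.algebraMap_eq_smul_one]

theorem sum_aeval_sq (p : ℝ[X]) :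
    ∑ u, ∑ v, aeval (G.adjMatrix ℝ) p u v ^ 2 = (aeval (G.adjMatrix ℝ) (p ^ 2)).trace := by
  rw [pow_two p, map_mul]
  simp only [Matrix.trace, Matrix.diag_apply, Matrix.mul_apply]
  refine Finset.sum_congr rfl fun u _ => Finset.sum_congr rfl fun v _ => ?_
  have := congrFun (congrFun (transpose_aeval_adjMatrix G p) u) v
  rw [Matrix.transpose_apply] at this
  rw [this, sq]

variable {G} in
-- Since `p(A)` is symmetric, the sum of its squared entries is `∑ mᵢ p(θᵢ)²`. Both sides are sums
-- of nonnegative terms, so they vanish together. Matrix identities thus reduce to checks at four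
-- points.
theorem HasSpectrum.aeval_eq_zero_iff {θ : Fin 4 → ℝ} {m : Fin 4 → ℕ} (h : HasSpectrum G θ m)
    (hm : ∀ i, 0 < m i) (p : ℝ[X]) :
    aeval (G.adjMatrix ℝ) p = 0 ↔ ∀ i, p.eval (θ i) = 0 := by
  have key := (sum_aeval_sq G p).trans (h.trace_aeval G _)
  constructor
  · intro h0 i
    rw [h0] at key
    simp only [Matrix.zero_apply, ne_eq, OfNat.ofNat_ne_zero, not_false_eq_true, zero_pow,
      Finset.sum_const_zero, eval_pow] at key
    have := (Finset.sum_eq_zero_iff_of_nonneg (fun i _ => by positivity)).1 key.symm i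
      (Finset.mem_univ i)
    have hmi : (m i : ℝ) ≠ 0 := by exact_mod_cast (hm i).ne'
    simpa [hmi] using this
  · intro h0
    simp only [eval_pow, h0] at key
    ext u v
    have h1 := (Finset.sum_eq_zero_iff_of_nonneg
      (fun u _ => Finset.sum_nonneg fun v _ => sq_nonneg _)).1 (key.trans (by simp)) u
      (Finset.mem_univ u)
    have h2 := (Finset.sum_eq_zero_iff_of_nonneg (fun v _ => sq_nonneg _)).1 h1 v
      (Finset.mem_univ v)
    simpa using h2

/-- The all-ones matrix. -/
def allOnes (V : Type*) : Matrix V V ℝ := Matrix.of fun _ _ => 1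

variable {G}

omit [DecidableEq V] in
theorem adjMatrix_mul_allOnes {k : ℕ} (hreg : G.IsRegularOfDegree k) :
    G.adjMatrix ℝ * allOnes V = (k : ℝ) • allOnes V := by
  ext u v
  simp [allOnes, hreg.degree_eq]

theorem aeval_mul_allOnes {k : ℕ} (hreg : G.IsRegularOfDegree k) (p : ℝ[X]) :
    aeval (G.adjMatrix ℝ) p * allOnes V = p.eval (k : ℝ) • allOnes V := by
  induction p using Polynomial.induction_on with
  | C a => simp [Algebra.algebraMap_eq_smul_one]
  | add p q hp hq => simp [add_mul, hp, hq, add_smul]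
  | monomial n a ih =>
    have : C a * X ^ (n + 1) = (C a * X ^ n) * (X : ℝ[X]) := by ring
    rw [this, map_mul, Matrix.mul_assoc, aeval_X, adjMatrix_mul_allOnes hreg, Matrix.mul_smul, ih,
      smul_smul, eval_mul (p := C a * X ^ n), eval_X, mul_comm]

theorem sum_aeval_row {k : ℕ} (hreg : G.IsRegularOfDegree k) (p : ℝ[X]) (u : V) :
    ∑ v, aeval (G.adjMatrix ℝ) p u v = p.eval (k : ℝ) := by
  have := congrFun (congrFun (aeval_mul_allOnes hreg p) u) u
  simpa [Matrix.mul_apply, allOnes] using this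

/-- Hoffman's polynomial identity, up to scaling. -/
theorem exists_aeval_eq_smul_allOnes {k : ℕ} {θ : Fin 4 → ℝ} {m : Fin 4 → ℕ}
    (hconn : G.Connected) (hreg : G.IsRegularOfDegree k)
    (hθ : StrictAnti θ) (hθ0 : θ 0 = k) (hm : ∀ i, 0 < m i) (hspec : HasSpectrum G θ m) :
    ∃ c : ℝ, c ≠ 0 ∧
      aeval (G.adjMatrix ℝ) ((X - C (θ 1)) * (X - C (θ 2)) * (X - C (θ 3))) = c • allOnes V := by
  set P : ℝ[X] := (X - C (θ 1)) * (X - C (θ 2)) * (X - C (θ 3)) with hP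
  have h0 : aeval (G.adjMatrix ℝ) ((X - C (k : ℝ)) * P) = 0 := by
    rw [hspec.aeval_eq_zero_iff hm]
    intro i
    fin_cases i <;> simp [hP, hθ0]
  have hcol : ∀ u u' v, aeval (G.adjMatrix ℝ) P u v = aeval (G.adjMatrix ℝ) P u' v := by
    intro u u' v
    -- From `(A - k) P(A) = 0`, each column of `P(A)` lies in the kernel of the Laplacian, hence is
    -- constant on a connected graph.
    have hx : G.lapMatrix ℝ *ᵥ (fun w => aeval (G.adjMatrix ℝ) P w v) = 0 := by
      ext w
      have := congrFun (congrFun h0 w) v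
      simp only [map_mul, map_sub, aeval_X, aeval_C, sub_mul, Matrix.sub_apply,
        Algebra.algebraMap_eq_smul_one, Matrix.smul_mul, Matrix.one_mul,
        Matrix.smul_apply, Matrix.zero_apply, SimpleGraph.adjMatrix_mul_apply] at this
      rw [SimpleGraph.lapMatrix_mulVec_apply, hreg.degree_eq]
      simp only [smul_eq_mul] at this
      simp only [Pi.zero_apply]
      linarith
    exact (G.lapMatrix_mulVec_eq_zero_iff_forall_reachable.1 hx) u u' (hconn.preconnected u u')
  have hsym : ∀ u v, aeval (G.adjMatrix ℝ) P u v = aeval (G.adjMatrix ℝ) P v u := by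
    intro u v
    have := congrFun (congrFun (transpose_aeval_adjMatrix G P) v) u
    rwa [Matrix.transpose_apply] at this
  obtain ⟨w⟩ := hconn.nonempty
  have heq : aeval (G.adjMatrix ℝ) P = aeval (G.adjMatrix ℝ) P w w • allOnes V := by
    ext u v
    simp only [Matrix.smul_apply, allOnes, Matrix.of_apply, smul_eq_mul, mul_one]
    rw [hcol u w v, hsym w v, hcol v w w]
  refine ⟨_, ?_, heq⟩
  intro hc
  rw [hc, zero_smul, hspec.aeval_eq_zero_iff hm] at heq
  have := heq 0
  have h1 : θ 1 < θ 0 := hθ (by decide)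
  have h2 : θ 2 < θ 0 := hθ (by decide)
  have h3 : θ 3 < θ 0 := hθ (by decide)
  simp [hP, sub_eq_zero, h1.ne', h2.ne', h3.ne'] at this

theorem exists_adj {θ : Fin 4 → ℝ} {m : Fin 4 → ℕ} (hθ : StrictAnti θ) (hm : ∀ i, 0 < m i)
    (hspec : HasSpectrum G θ m) : ∃ u v, G.Adj u v := by
  by_contra! h
  have h0 : aeval (G.adjMatrix ℝ) (X : ℝ[X]) = 0 := by
    ext u v
    simp [h]
  rw [hspec.aeval_eq_zero_iff hm] at h0
  have h1 := h0 0
  have h2 := h0 1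
  have : θ 1 < θ 0 := hθ (by decide)
  simp at h1 h2
  linarith

/-- `A - θ₃ I` is positive semidefinite; testing it on `e_u - e_v` for an edge `uv` gives `-2θ₃ - 2
≥ 0`. Semidefiniteness comes from an explicit square root `h(A)`, with `h` interpolating `√(θᵢ -
θ₃)`. -/
theorem smallest_eigenvalue_le_neg_one {θ : Fin 4 → ℝ} {m : Fin 4 → ℕ} (hθ : StrictAnti θ)
    (hm : ∀ i, 0 < m i) (hspec : HasSpectrum G θ m) : θ 3 ≤ -1 := by
  obtain ⟨u, v, huv⟩ := exists_adj hθ hm hspec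
  set h : ℝ[X] := Lagrange.interpolate Finset.univ θ fun i => Real.sqrt (θ i - θ 3) with hh
  have hev : ∀ i, h.eval (θ i) = Real.sqrt (θ i - θ 3) := fun i =>
    Lagrange.eval_interpolate_at_node _ hθ.injective.injOn (Finset.mem_univ i)
  have h0 : aeval (G.adjMatrix ℝ) (X - C (θ 3) - h * h) = 0 := by
    rw [hspec.aeval_eq_zero_iff hm]
    intro i
    have : θ 3 ≤ θ i := hθ.antitone (Fin.le_last i)
    simp [hev, Real.mul_self_sqrt (sub_nonneg.2 this)]
  rw [map_sub, sub_eq_zero, map_mul] at h0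
  have hsym : ∀ u v, aeval (G.adjMatrix ℝ) h u v = aeval (G.adjMatrix ℝ) h v u := by
    intro u v
    have := congrFun (congrFun (transpose_aeval_adjMatrix G h) v) u
    rwa [Matrix.transpose_apply] at this
  have e : ∀ u v, (G.adjMatrix ℝ) u v - θ 3 * (1 : Matrix V V ℝ) u v =
      ∑ w, aeval (G.adjMatrix ℝ) h u w * aeval (G.adjMatrix ℝ) h v w := by
    intro u v
    have := congrFun (congrFun h0 u) v
    simp only [Matrix.mul_apply, map_sub, aeval_X, aeval_C, Matrix.sub_apply,
      Algebra.algebraMap_eq_smul_one, Matrix.smul_apply, smul_eq_mul] at this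
    rw [this]
    exact Finset.sum_congr rfl fun w _ => by rw [hsym v w]
  have e1 := e u u
  have e2 := e v v
  have e3 := e u v
  have : 0 ≤ ∑ w, (aeval (G.adjMatrix ℝ) h u w - aeval (G.adjMatrix ℝ) h v w) ^ 2 :=
    Finset.sum_nonneg fun w _ => sq_nonneg _
  have hsq : ∀ a b : V → ℝ, ∑ w, (a w - b w) ^ 2 =
      ∑ w, a w * a w + ∑ w, b w * b w - 2 * ∑ w, a w * b w := by
    intro a b
    rw [Finset.mul_sum, ← Finset.sum_add_distrib, ← Finset.sum_sub_distrib]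
    exact Finset.sum_congr rfl fun w _ => by ring
  rw [hsq, ← e1, ← e2, ← e3] at this
  simp [huv, huv.ne] at this
  linarith

end


/-! ### The Cauchy-Schwarz bound for quadratics -/

section

variable {V : Type*} [Fintype V] [DecidableEq V] (G : SimpleGraph V) [DecidableRel G.Adj]

theorem aeval_apply_eq_zero_of_natDegree_lt_dist {p : ℝ[X]} {u v : V}
    (h : p.natDegree < G.dist u v) : aeval (G.adjMatrix ℝ) p u v = 0 := by
  rw [aeval_eq_sum_range, Matrix.sum_apply]
  refine Finset.sum_eq_zero fun i hi => ?_
  rw [Matrix.smul_apply, G.adjMatrix_pow_apply_eq_card_walk, Fintype.card_eq_zero_iff.2, Nat.cast_zero,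
    smul_zero]
  refine ⟨fun ⟨w, hw⟩ => ?_⟩
  have := SimpleGraph.dist_le w
  simp only [Set.mem_ofPred_eq] at hw
  have := Finset.mem_range.1 hi
  omega

/-- The matrix `I + A₁ + A₂`: its entry at `u, v` is `1` when `u` and `v` are at distance at most
`2`, and `0` otherwise. -/
noncomputable def nearMatrix : Matrix V V ℝ := Matrix.of fun u v => if G.dist u v ≤ 2 then 1 else 0

/-- The monic quadratic `x² - α x + β`. -/
noncomputable def quad (α β : ℝ) : ℝ[X] := X ^ 2 - C α * X + C β

theorem eval_quad (α β x : ℝ) : (quad α β).eval x = x ^ 2 - α * x + β := by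
  simp [quad]

theorem natDegree_quad_le (α β : ℝ) : (quad α β).natDegree ≤ 2 := by
  unfold quad
  compute_degree

theorem quad_apply_eq_zero {α β : ℝ} {u v : V} (h : ¬ G.dist u v ≤ 2) :
    aeval (G.adjMatrix ℝ) (quad α β) u v = 0 :=
  aeval_apply_eq_zero_of_natDegree_lt_dist G (by have := natDegree_quad_le α β; omega)

theorem quad_apply_mul_nearMatrix (α β : ℝ) (u v : V) :
    aeval (G.adjMatrix ℝ) (quad α β) u v * nearMatrix G u v =
      aeval (G.adjMatrix ℝ) (quad α β) u v := by
  by_cases h : G.dist u v ≤ 2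
  · simp [nearMatrix, h]
  · simp [quad_apply_eq_zero G h]

variable {G}

/-- A monic quadratic has no three distinct roots. This keeps the denominator of the bound positive
and rules out `c = 0` and `N = J` in the equality case. -/
theorem quad_eval_ne_zero {θ : Fin 4 → ℝ} (hθ : StrictAnti θ) {α β : ℝ}
    (h1 : (quad α β).eval (θ 1) = 0) (h2 : (quad α β).eval (θ 2) = 0) :
    (quad α β).eval (θ 3) ≠ 0 := by
  intro h3
  rw [eval_quad] at h1 h2 h3
  have h12 : θ 2 < θ 1 := hθ (by decide)
  have h13 : θ 3 < θ 1 := hθ (by decide)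
  have h23 : θ 3 < θ 2 := hθ (by decide)
  have e1 : (θ 1 - θ 2) * (θ 1 + θ 2 - α) = 0 := by linarith
  have e2 : (θ 1 - θ 3) * (θ 1 + θ 3 - α) = 0 := by linarith
  rcases mul_eq_zero.1 e1 with h | h <;> rcases mul_eq_zero.1 e2 with h' | h' <;> linarith

theorem sum_quad_sq_pos {θ : Fin 4 → ℝ} {m : Fin 4 → ℕ} (hθ : StrictAnti θ)
    (hm : ∀ i, 0 < m i) (α β : ℝ) :
    0 < ∑ i ∈ {1, 2, 3}, (m i : ℝ) * (quad α β).eval (θ i) ^ 2 := by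
  refine lt_of_le_of_ne (Finset.sum_nonneg fun i _ => by positivity) fun h => ?_
  have h0 := (Finset.sum_eq_zero_iff_of_nonneg fun i _ => by positivity).1 h.symm
  have hz : ∀ i ∈ ({1, 2, 3} : Finset (Fin 4)), (quad α β).eval (θ i) = 0 := by
    intro i hi
    have := h0 i hi
    have hmi : (m i : ℝ) ≠ 0 := by exact_mod_cast (hm i).ne'
    simpa [hmi] using this
  exact quad_eval_ne_zero hθ (hz 1 (by simp)) (hz 2 (by simp)) (hz 3 (by simp))

theorem sum_eq_zero_term_add {f : Fin 4 → ℝ} {m : Fin 4 → ℕ} (hm0 : m 0 = 1) :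
    ∑ i, (m i : ℝ) * f i = f 0 + ∑ i ∈ {1, 2, 3}, (m i : ℝ) * f i := by
  rw [Fin.sum_univ_four]
  simp [hm0, Finset.sum_insert]
  ring

variable {k : ℕ} {θ : Fin 4 → ℝ} {m : Fin 4 → ℕ}

/-- Hoffman's cubic in `A` has no zero entry, while a cubic in `A` vanishes at distance above `3`.
-/
theorem dist_le_three (hconn : G.Connected) (hreg : G.IsRegularOfDegree k)
    (hθ : StrictAnti θ) (hθ0 : θ 0 = k) (hm : ∀ i, 0 < m i) (hspec : HasSpectrum G θ m)
    (u v : V) : G.dist u v ≤ 3 := by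
  obtain ⟨c, hc, h⟩ := exists_aeval_eq_smul_allOnes hconn hreg hθ hθ0 hm hspec
  by_contra! hd
  have hdeg : ((X - C (θ 1)) * (X - C (θ 2)) * (X - C (θ 3))).natDegree ≤ 3 := by
    compute_degree
  have := aeval_apply_eq_zero_of_natDegree_lt_dist G (hdeg.trans_lt hd)
  rw [h] at this
  simp [allOnes, hc] at this

omit [DecidableEq V] [DecidableRel G.Adj] in
theorem sum_nearMatrix (hne : Nonempty V) (hd : ∀ u v, G.dist u v ≤ 3) :
    ∑ u, ∑ v, nearMatrix G u v =
      (Fintype.card V : ℝ) * ((Fintype.card V : ℝ) - avgAtDist G 3) := by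
  classical
  have hcard : (Fintype.card V : ℝ) ≠ 0 := by exact_mod_cast Fintype.card_ne_zero
  have h1 : ∀ u, ∑ v, nearMatrix G u v = (Fintype.card V : ℝ) - numAtDist G 3 u := by
    intro u
    have : ∀ v, nearMatrix G u v = 1 - if G.dist u v = 3 then 1 else 0 := by
      intro v
      have := hd u v
      by_cases h : G.dist u v ≤ 2
      · have h' : G.dist u v ≠ 3 := by omega
        simp [nearMatrix, h, h']
      · have h' : G.dist u v = 3 := by omega
        simp [nearMatrix, h']
    simp only [this, Finset.sum_sub_distrib, numAtDist]
    simp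
  simp only [h1, Finset.sum_sub_distrib, avgAtDist]
  simp only [Finset.sum_const, Finset.card_univ, nsmul_eq_mul]
  field_simp

/-- The entries of `N` are idempotent and `N` is `1` on the support of `q(A)`, so the cross term is
just the sum of the entries of `q(A)`, known from its row sums. -/
theorem sum_sq_sub_smul_nearMatrix (hreg : G.IsRegularOfDegree k) (hθ0 : θ 0 = k)
    (hspec : HasSpectrum G θ m) (hne : Nonempty V) (hd : ∀ u v, G.dist u v ≤ 3) (α β c : ℝ) :
    ∑ u, ∑ v, (aeval (G.adjMatrix ℝ) (quad α β) u v - c * nearMatrix G u v) ^ 2 =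
      ∑ i, (m i : ℝ) * (quad α β).eval (θ i) ^ 2 -
        2 * c * (Fintype.card V * (quad α β).eval (θ 0)) +
        c ^ 2 * (Fintype.card V * (Fintype.card V - avgAtDist G 3)) := by
  have hN : ∀ u v, nearMatrix G u v ^ 2 = nearMatrix G u v := by
    intro u v
    simp only [nearMatrix, Matrix.of_apply]
    split_ifs <;> simp
  have h1 := (sum_aeval_sq G (quad α β)).trans (hspec.trace_aeval G _)
  simp only [eval_pow] at h1
  have h2 : ∑ u, ∑ v, aeval (G.adjMatrix ℝ) (quad α β) u v =
      Fintype.card V * (quad α β).eval (θ 0) := by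
    simp [sum_aeval_row hreg, hθ0]
  rw [← h1, ← h2, ← sum_nearMatrix hne hd, Finset.mul_sum, Finset.mul_sum,
    ← Finset.sum_sub_distrib, ← Finset.sum_add_distrib]
  refine Finset.sum_congr rfl fun u _ => ?_
  rw [Finset.mul_sum, Finset.mul_sum, ← Finset.sum_sub_distrib, ← Finset.sum_add_distrib]
  refine Finset.sum_congr rfl fun v _ => ?_
  linear_combination c ^ 2 * hN u v - 2 * c * quad_apply_mul_nearMatrix G α β u v

omit [DecidableEq V] [DecidableRel G.Adj] in
theorem avgAtDist_lt_card (hne : Nonempty V) (hd : ∀ u v, G.dist u v ≤ 3) :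
    0 < (Fintype.card V : ℝ) - avgAtDist G 3 := by
  have hpos : 0 < ∑ u, ∑ v, nearMatrix G u v := by
    obtain ⟨w⟩ := hne
    have hnn : ∀ u v, 0 ≤ nearMatrix G u v := by
      intro u v
      simp only [nearMatrix, Matrix.of_apply]
      split_ifs <;> simp
    refine Finset.sum_pos' (fun u _ => Finset.sum_nonneg fun v _ => hnn u v)
      ⟨w, Finset.mem_univ _, Finset.sum_pos' (fun v _ => hnn w v) ⟨w, Finset.mem_univ _, ?_⟩⟩
    simp [nearMatrix]
  rw [sum_nearMatrix hne hd] at hpos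
  exact (mul_pos_iff_of_pos_left (by exact_mod_cast Fintype.card_pos)).1 hpos

/-- The Cauchy-Schwarz bound on the average number of vertices at distance three, with its case of
equality. -/
theorem avgAtDist_le_and_eq_iff (hreg : G.IsRegularOfDegree k) (hθ : StrictAnti θ)
    (hθ0 : θ 0 = k) (hm : ∀ i, 0 < m i) (hm0 : m 0 = 1)
    (hspec : HasSpectrum G θ m) (hne : Nonempty V) (hd : ∀ u v, G.dist u v ≤ 3) (α β : ℝ) :
    avgAtDist G 3 ≤ (Fintype.card V * ∑ i ∈ {1, 2, 3}, (m i : ℝ) * (quad α β).eval (θ i) ^ 2) /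
        ∑ i, (m i : ℝ) * (quad α β).eval (θ i) ^ 2 ∧
    (avgAtDist G 3 = (Fintype.card V * ∑ i ∈ {1, 2, 3}, (m i : ℝ) * (quad α β).eval (θ i) ^ 2) /
        ∑ i, (m i : ℝ) * (quad α β).eval (θ i) ^ 2 ↔
      ∃ c : ℝ, aeval (G.adjMatrix ℝ) (quad α β) = c • nearMatrix G) := by
  have key := sum_sq_sub_smul_nearMatrix hreg hθ0 hspec hne hd α β
  have hpos := sum_quad_sq_pos hθ hm α β
  have hlt := avgAtDist_lt_card hne hd
  have hn : (0 : ℝ) < Fintype.card V := by exact_mod_cast Fintype.card_pos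
  rw [sum_eq_zero_term_add hm0] at key ⊢
  set a := (quad α β).eval (θ 0)
  set T := ∑ i ∈ {1, 2, 3}, (m i : ℝ) * (quad α β).eval (θ i) ^ 2
  set n : ℝ := (Fintype.card V : ℝ)
  set x := avgAtDist G 3
  have hR : 0 < a ^ 2 + T := by positivity
  -- This is the coefficient of the orthogonal projection of `q(A)` onto `N`; the residual is the
  -- Cauchy-Schwarz defect.
  have key' := key (a / (n - x))
  have e : a ^ 2 + T - 2 * (a / (n - x)) * (n * a) + (a / (n - x)) ^ 2 * (n * (n - x)) =
      (n * T - x * (a ^ 2 + T)) / (n - x) := by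
    field_simp
    ring
  rw [e] at key'
  have hnn : 0 ≤ (n * T - x * (a ^ 2 + T)) / (n - x) :=
    key' ▸ Finset.sum_nonneg fun u _ => Finset.sum_nonneg fun v _ => sq_nonneg _
  refine ⟨?_, ?_, ?_⟩
  · rw [le_div_iff₀ hR]
    have := (le_div_iff₀ hlt).1 hnn
    linarith
  · intro h
    rw [eq_div_iff hR.ne'] at h
    refine ⟨a / (n - x), ?_⟩
    rw [← h, sub_self, zero_div] at key'
    ext u v
    have h1 := (Finset.sum_eq_zero_iff_of_nonneg
      (fun u _ => Finset.sum_nonneg fun v _ => sq_nonneg _)).1 key' u (Finset.mem_univ u)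
    have h2 := (Finset.sum_eq_zero_iff_of_nonneg (fun v _ => sq_nonneg _)).1 h1 v
      (Finset.mem_univ v)
    simpa [sub_eq_zero] using h2
  · rintro ⟨c, hc⟩
    -- Two expressions for `‖q(A) - tN‖²`, valid for every `t`; comparing them at `t = 0` and `t =
    -- 1` yields `a` and `a² + T` in terms of `c`.
    have hz : ∀ t : ℝ, a ^ 2 + T - 2 * t * (n * a) + t ^ 2 * (n * (n - x)) =
        (c - t) ^ 2 * (n * (n - x)) := by
      intro t
      rw [← key t, hc, ← sum_nearMatrix hne hd, Finset.mul_sum]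
      refine Finset.sum_congr rfl fun u _ => ?_
      rw [Finset.mul_sum]
      refine Finset.sum_congr rfl fun v _ => ?_
      simp only [Matrix.smul_apply, smul_eq_mul, nearMatrix, Matrix.of_apply]
      split_ifs <;> ring
    have h0 := hz 0
    have h1 := hz 1
    have ha : a = c * (n - x) := by
      have : n * (a - c * (n - x)) = 0 := by linarith
      rcases mul_eq_zero.1 this with h | h <;> linarith
    rw [eq_div_iff hR.ne']
    have hR2 : a ^ 2 + T = c ^ 2 * (n * (n - x)) := by linarith
    have hT : T = c ^ 2 * (n * (n - x)) - a ^ 2 := by linarith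
    rw [hR2, hT, ha]
    ring

end


/-! ### Equality implies distance-regular and strongly regular -/

section

variable {V : Type*} [Fintype V] [DecidableEq V] {G : SimpleGraph V} [DecidableRel G.Adj]
  {k : ℕ} {θ : Fin 4 → ℝ} {m : Fin 4 → ℕ}

/-- On the spectrum such a `p` agrees with a multiple of Hoffman's cubic, the factor being fixed by
the value at `θ₀`. -/
theorem exists_aeval_eq_smul_allOnes_of_eval_eq_zero (hconn : G.Connected)
    (hreg : G.IsRegularOfDegree k) (hθ : StrictAnti θ) (hθ0 : θ 0 = k) (hm : ∀ i, 0 < m i)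
    (hspec : HasSpectrum G θ m) (p : ℝ[X]) (h1 : p.eval (θ 1) = 0) (h2 : p.eval (θ 2) = 0)
    (h3 : p.eval (θ 3) = 0) : ∃ t : ℝ, aeval (G.adjMatrix ℝ) p = t • allOnes V := by
  obtain ⟨c, -, h⟩ := exists_aeval_eq_smul_allOnes hconn hreg hθ hθ0 hm hspec
  set P : ℝ[X] := (X - C (θ 1)) * (X - C (θ 2)) * (X - C (θ 3)) with hP
  have hP0 : P.eval (θ 0) ≠ 0 := by
    have h1 : θ 1 < θ 0 := hθ (by decide)
    have h2 : θ 2 < θ 0 := hθ (by decide)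
    have h3 : θ 3 < θ 0 := hθ (by decide)
    simp [hP, sub_eq_zero, h1.ne', h2.ne', h3.ne']
  refine ⟨p.eval (θ 0) / P.eval (θ 0) * c, ?_⟩
  have h0 : aeval (G.adjMatrix ℝ) (p - C (p.eval (θ 0) / P.eval (θ 0)) * P) = 0 := by
    rw [hspec.aeval_eq_zero_iff hm]
    intro i
    fin_cases i
    · simp [hP0]
    · simp [hP, h1]
    · simp [hP, h2]
    · simp [hP, h3]
  rw [map_sub, sub_eq_zero, map_mul, h] at h0
  rw [h0]
  simp [Algebra.algebraMap_eq_smul_one, smul_smul, mul_comm]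

theorem eval_eq_zero_of_aeval_eq_smul_allOnes (hconn : G.Connected)
    (hreg : G.IsRegularOfDegree k) (hθ : StrictAnti θ) (hθ0 : θ 0 = k) (hm : ∀ i, 0 < m i)
    (hspec : HasSpectrum G θ m) {p : ℝ[X]} {t : ℝ}
    (hp : aeval (G.adjMatrix ℝ) p = t • allOnes V) :
    p.eval (θ 1) = 0 ∧ p.eval (θ 2) = 0 ∧ p.eval (θ 3) = 0 := by
  obtain ⟨c, hc, h⟩ := exists_aeval_eq_smul_allOnes hconn hreg hθ hθ0 hm hspec
  set P : ℝ[X] := (X - C (θ 1)) * (X - C (θ 2)) * (X - C (θ 3)) with hP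
  have h0 : aeval (G.adjMatrix ℝ) (p - C (t / c) * P) = 0 := by
    rw [map_sub, map_mul, h, hp]
    simp [Algebra.algebraMap_eq_smul_one, smul_smul, mul_div_cancel₀ _ hc]
  rw [hspec.aeval_eq_zero_iff hm] at h0
  have e1 := h0 1
  have e2 := h0 2
  have e3 := h0 3
  simp [hP] at e1 e2 e3
  exact ⟨e1, e2, e3⟩

theorem ne_zero_of_quad_eq_smul_nearMatrix (hθ : StrictAnti θ) (hm : ∀ i, 0 < m i)
    (hspec : HasSpectrum G θ m) {α β c : ℝ}
    (h : aeval (G.adjMatrix ℝ) (quad α β) = c • nearMatrix G) : c ≠ 0 := by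
  rintro rfl
  rw [zero_smul, hspec.aeval_eq_zero_iff hm] at h
  exact quad_eval_ne_zero hθ (h 1) (h 2) (h 3)

theorem nearMatrix_ne_allOnes (hconn : G.Connected)
    (hreg : G.IsRegularOfDegree k) (hθ : StrictAnti θ) (hθ0 : θ 0 = k) (hm : ∀ i, 0 < m i)
    (hspec : HasSpectrum G θ m) {α β c : ℝ}
    (h : aeval (G.adjMatrix ℝ) (quad α β) = c • nearMatrix G) : nearMatrix G ≠ allOnes V := by
  intro hN
  rw [hN] at h
  obtain ⟨h1, h2, h3⟩ :=
    eval_eq_zero_of_aeval_eq_smul_allOnes hconn hreg hθ hθ0 hm hspec h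
  exact quad_eval_ne_zero hθ h1 h2 h3

/-- The entries of the matrix depend only on the distance between the two vertices. -/
def IsDistFun (G : SimpleGraph V) (M : Matrix V V ℝ) : Prop :=
  ∃ f : ℕ → ℝ, ∀ u v, M u v = f (G.dist u v)

omit [Fintype V] [DecidableEq V] [DecidableRel G.Adj] in
theorem IsDistFun.add {M N : Matrix V V ℝ} (hM : IsDistFun G M) (hN : IsDistFun G N) :
    IsDistFun G (M + N) := by
  obtain ⟨f, hf⟩ := hM
  obtain ⟨g, hg⟩ := hN
  exact ⟨fun i => f i + g i, fun u v => by simp [hf, hg]⟩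

omit [Fintype V] [DecidableEq V] [DecidableRel G.Adj] in
theorem IsDistFun.smul {M : Matrix V V ℝ} (hM : IsDistFun G M) (a : ℝ) :
    IsDistFun G (a • M) := by
  obtain ⟨f, hf⟩ := hM
  exact ⟨fun i => a * f i, fun u v => by simp [hf]⟩

omit [Fintype V] [DecidableEq V] [DecidableRel G.Adj] in
theorem IsDistFun.sub {M N : Matrix V V ℝ} (hM : IsDistFun G M) (hN : IsDistFun G N) :
    IsDistFun G (M - N) := by
  obtain ⟨f, hf⟩ := hM
  obtain ⟨g, hg⟩ := hN
  exact ⟨fun i => f i - g i, fun u v => by simp [hf, hg]⟩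

omit [Fintype V] [DecidableRel G.Adj] in
theorem isDistFun_one (hconn : G.Connected) : IsDistFun G (1 : Matrix V V ℝ) :=
  ⟨fun i => if i = 0 then 1 else 0, fun u v => by
    simp [Matrix.one_apply, hconn.dist_eq_zero_iff]⟩

omit [Fintype V] [DecidableEq V] in
theorem isDistFun_adjMatrix : IsDistFun G (G.adjMatrix ℝ) :=
  ⟨fun i => if i = 1 then 1 else 0, fun u v => by
    simp [SimpleGraph.adjMatrix_apply, SimpleGraph.dist_eq_one_iff_adj]⟩

omit [Fintype V] [DecidableEq V] [DecidableRel G.Adj] in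
theorem isDistFun_nearMatrix : IsDistFun G (nearMatrix G) :=
  ⟨fun i => if i ≤ 2 then 1 else 0, fun _ _ => rfl⟩

omit [Fintype V] [DecidableEq V] [DecidableRel G.Adj] in
theorem isDistFun_allOnes : IsDistFun G (allOnes V) := ⟨fun _ => 1, fun _ _ => rfl⟩

/-- Dividing `x q` by Hoffman's cubic and then by `q` leaves a linear remainder, so `c A N` is a
combination of `J`, `N`, `A` and `I`. -/
theorem isDistFun_mul_nearMatrix (hconn : G.Connected)
    (hreg : G.IsRegularOfDegree k) (hθ : StrictAnti θ) (hθ0 : θ 0 = k) (hm : ∀ i, 0 < m i)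
    (hspec : HasSpectrum G θ m) {α β c : ℝ}
    (h : aeval (G.adjMatrix ℝ) (quad α β) = c • nearMatrix G) :
    IsDistFun G (G.adjMatrix ℝ * nearMatrix G) := by
  have hc := ne_zero_of_quad_eq_smul_nearMatrix hθ hm hspec h
  obtain ⟨d, -, hP⟩ := exists_aeval_eq_smul_allOnes hconn hreg hθ hθ0 hm hspec
  set σ₁ := θ 1 + θ 2 + θ 3
  set σ₂ := θ 1 * θ 2 + θ 1 * θ 3 + θ 2 * θ 3
  have hpoly : X * quad α β = (X - C (θ 1)) * (X - C (θ 2)) * (X - C (θ 3)) +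
      C (σ₁ - α) * quad α β + C (β - σ₂ + α * (σ₁ - α)) * X +
      C (θ 1 * θ 2 * θ 3 - (σ₁ - α) * β) := by
    simp only [quad, σ₁, σ₂, map_add, map_sub, map_mul]
    ring
  have hmat := congrArg (aeval (G.adjMatrix ℝ)) hpoly
  simp only [map_add (aeval (G.adjMatrix ℝ)), map_mul (aeval (G.adjMatrix ℝ)), aeval_C, h] at hmat
  simp only [map_mul (aeval (G.adjMatrix ℝ))] at hP
  rw [hP] at hmat
  simp only [aeval_X, Algebra.algebraMap_eq_smul_one, Matrix.smul_mul, Matrix.mul_smul,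
    Matrix.one_mul] at hmat
  have : G.adjMatrix ℝ * nearMatrix G = c⁻¹ • (c • (G.adjMatrix ℝ * nearMatrix G)) := by
    rw [smul_smul, inv_mul_cancel₀ hc, one_smul]
  rw [this, hmat]
  exact ((((isDistFun_allOnes.smul _).add ((isDistFun_nearMatrix.smul _).smul _)).add
    (isDistFun_adjMatrix.smul _)).add ((isDistFun_one hconn).smul _)).smul _

theorem aeval_quad (α β : ℝ) : aeval (G.adjMatrix ℝ) (quad α β) =
    G.adjMatrix ℝ * G.adjMatrix ℝ - α • G.adjMatrix ℝ + β • (1 : Matrix V V ℝ) := by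
  simp only [quad, map_add, map_sub, map_mul, aeval_X, aeval_C, sq,
    Algebra.algebraMap_eq_smul_one, Matrix.smul_mul, Matrix.one_mul]

theorem adjMatrix_mul_self_eq {α β c : ℝ}
    (h : aeval (G.adjMatrix ℝ) (quad α β) = c • nearMatrix G) :
    G.adjMatrix ℝ * G.adjMatrix ℝ =
      c • nearMatrix G + α • G.adjMatrix ℝ - β • (1 : Matrix V V ℝ) := by
  rw [← h, aeval_quad]
  abel

/-- The distance matrices `D j` are combinations of `I, A, N, J`, and `A` times each of these
depends only on distance. The entries of `A * D j` are the counts that define distance-regularity.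
-/
theorem isDistanceRegular_of_quad_eq (hconn : G.Connected)
    (hreg : G.IsRegularOfDegree k) (hθ : StrictAnti θ) (hθ0 : θ 0 = k) (hm : ∀ i, 0 < m i)
    (hspec : HasSpectrum G θ m) {α β c : ℝ}
    (h : aeval (G.adjMatrix ℝ) (quad α β) = c • nearMatrix G) :
    IsDistanceRegular G := by
  classical
  have hd := dist_le_three hconn hreg hθ hθ0 hm hspec
  have hAN := isDistFun_mul_nearMatrix hconn hreg hθ hθ0 hm hspec h
  let D : ℕ → Matrix V V ℝ := fun j => Matrix.of fun u v => if G.dist u v = j then 1 else 0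
  have hAA : IsDistFun G (G.adjMatrix ℝ * G.adjMatrix ℝ) := by
    rw [adjMatrix_mul_self_eq h]
    exact ((isDistFun_nearMatrix.smul _).add (isDistFun_adjMatrix.smul _)).sub
      ((isDistFun_one hconn).smul _)
  have hD0 : D 0 = 1 := by
    ext u v
    simp [D, Matrix.one_apply, hconn.dist_eq_zero_iff]
  have hD1 : D 1 = G.adjMatrix ℝ := by
    ext u v
    simp [D, SimpleGraph.adjMatrix_apply, SimpleGraph.dist_eq_one_iff_adj]
  have hD2 : D 2 = nearMatrix G - 1 - G.adjMatrix ℝ := by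
    rw [← hD0, ← hD1]
    ext u v
    have := hd u v
    simp only [D, nearMatrix, Matrix.sub_apply, Matrix.of_apply]
    generalize G.dist u v = i at *
    interval_cases i <;> simp
  have hD3 : D 3 = allOnes V - nearMatrix G := by
    ext u v
    have := hd u v
    simp only [D, nearMatrix, allOnes, Matrix.sub_apply, Matrix.of_apply]
    generalize G.dist u v = i at *
    interval_cases i <;> simp
  have hDj : ∀ j, 4 ≤ j → D j = 0 := by
    intro j hj
    ext u v
    have := hd u v
    have : G.dist u v ≠ j := by omega
    simp [D, this]
  have hAD : ∀ j, IsDistFun G (G.adjMatrix ℝ * D j) := by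
    intro j
    rcases lt_or_ge j 4 with hj | hj
    · interval_cases j
      · rw [hD0, Matrix.mul_one]
        exact isDistFun_adjMatrix
      · rwa [hD1]
      · rw [hD2, mul_sub, mul_sub, Matrix.mul_one]
        exact (hAN.sub isDistFun_adjMatrix).sub hAA
      · rw [hD3, mul_sub, adjMatrix_mul_allOnes hreg]
        exact (isDistFun_allOnes.smul _).sub hAN
    · rw [hDj j hj, Matrix.mul_zero]
      exact ⟨fun _ => 0, fun _ _ => rfl⟩
  choose f hf using hAD
  -- The real number `f j (G.dist u v)` is a cardinality, so the floor recovers it exactly.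
  have hcard : ∀ j u v, (Finset.univ.filter fun w => G.Adj v w ∧ G.dist u w = j).card =
      ⌊f j (G.dist u v)⌋₊ := by
    intro j u v
    have : ((Finset.univ.filter fun w => G.Adj v w ∧ G.dist u w = j).card : ℝ) =
        f j (G.dist u v) := by
      rw [G.dist_comm, ← hf, SimpleGraph.adjMatrix_mul_apply]
      simp only [D, Matrix.of_apply, Finset.sum_boole]
      congr 2
      ext w
      simp [G.dist_comm]
    rw [← this, Nat.floor_natCast]
  refine ⟨hconn, fun i => ⌊f (i + 1) i⌋₊, fun i => if i = 0 then 0 else ⌊f (i - 1) i⌋₊,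
    fun u v => ⟨?_, ?_⟩⟩
  · refine Eq.trans ?_ (hcard (G.dist u v + 1) u v)
    congr
  · by_cases h0 : G.dist u v = 0
    · simp [h0]
    · dsimp only
      rw [if_neg h0, ← hcard]
      congr 1
      ext w
      simp only [Finset.mem_filter, Finset.mem_univ, true_and]
      refine and_congr_right fun _ => ?_
      omega

omit [Fintype V] [DecidableRel G.Adj] in
theorem nearMatrix_sub_one_apply (hconn : G.Connected) (u v : V)
    [Decidable ((distOneOrTwoGraph G).Adj u v)] :
    nearMatrix G u v - (1 : Matrix V V ℝ) u v =
      if (distOneOrTwoGraph G).Adj u v then 1 else 0 := by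
  by_cases huv : u = v
  · subst huv
    simp [nearMatrix]
  · have h0 : G.dist u v ≠ 0 := fun h => huv (hconn.dist_eq_zero_iff.1 h)
    have : (distOneOrTwoGraph G).Adj u v ↔ G.dist u v ≤ 2 := by
      simp only [distOneOrTwoGraph]
      omega
    simp [nearMatrix, this, huv]

/-- The product `(q - a)(q - b)` vanishes at `θ₁, θ₂, θ₃`, so `(cN - a)(cN - b)` is a multiple of
`J`. Hence `N²`, and with it the square of `N - I`, the adjacency matrix of `Γ₁,₂`, is a combination
of `I, N, J`. -/
theorem isStronglyRegular_of_quad_eq (hconn : G.Connected)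
    (hreg : G.IsRegularOfDegree k) (hθ : StrictAnti θ) (hθ0 : θ 0 = k) (hm : ∀ i, 0 < m i)
    (hspec : HasSpectrum G θ m) {α β c a b : ℝ}
    (h : aeval (G.adjMatrix ℝ) (quad α β) = c • nearMatrix G)
    (hab : ∀ i, i ≠ 0 → ((quad α β).eval (θ i) - a) * ((quad α β).eval (θ i) - b) = 0) :
    IsStronglyRegular (distOneOrTwoGraph G) := by
  classical
  have hc := ne_zero_of_quad_eq_smul_nearMatrix hθ hm hspec h
  have hM : (distOneOrTwoGraph G).adjMatrix ℝ = nearMatrix G - 1 := by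
    ext u v
    rw [SimpleGraph.adjMatrix_apply, Matrix.sub_apply, nearMatrix_sub_one_apply hconn]
  obtain ⟨t, ht⟩ := exists_aeval_eq_smul_allOnes_of_eval_eq_zero hconn hreg hθ hθ0 hm hspec
    ((quad α β - C a) * (quad α β - C b)) (by simpa using hab 1 (by decide))
    (by simpa using hab 2 (by decide)) (by simpa using hab 3 (by decide))
  have hN2 : ∀ u v, (nearMatrix G * nearMatrix G) u v = (t - a * b * (1 : Matrix V V ℝ) u v
      + c * (a + b) * nearMatrix G u v) / c ^ 2 := by
    intro u v
    have := congrFun (congrFun ht u) v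
    simp only [map_mul, map_sub, h, aeval_C, Algebra.algebraMap_eq_smul_one, sub_mul, mul_sub,
      Matrix.smul_mul, Matrix.mul_smul, Matrix.one_mul, Matrix.mul_one, Matrix.sub_apply,
      Matrix.smul_apply, smul_eq_mul, allOnes, Matrix.of_apply] at this
    rw [eq_div_iff (by positivity)]
    linarith
  have hrow : ∀ u, ∑ v, nearMatrix G u v = (quad α β).eval (k : ℝ) / c := by
    intro u
    have := sum_aeval_row hreg (quad α β) u
    rw [h] at this
    rw [← this, Finset.sum_div]
    simp [hc]
  have hcommon : ∀ u v, u ≠ v →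
      (Fintype.card ((distOneOrTwoGraph G).commonNeighbors u v) : ℝ) =
      (t + c * (a + b) * nearMatrix G u v) / c ^ 2 - 2 * nearMatrix G u v := by
    intro u v huv
    have h1 : (nearMatrix G - 1) * (nearMatrix G - 1) =
        nearMatrix G * nearMatrix G - 2 • nearMatrix G + 1 := by
      noncomm_ring
    have h2 := congrFun (congrFun h1 u) v
    rw [← hM, SimpleGraph.adjMatrix_mul_apply] at h2
    simp only [Matrix.add_apply, Matrix.sub_apply, Matrix.smul_apply, hN2, Matrix.one_apply_ne huv,
      SimpleGraph.adjMatrix_apply, Finset.sum_boole] at h2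
    have h3 : Fintype.card ((distOneOrTwoGraph G).commonNeighbors u v) =
        (((distOneOrTwoGraph G).neighborFinset u).filter
          fun w => (distOneOrTwoGraph G).Adj w v).card := by
      rw [← Set.toFinset_card]
      congr 1
      ext w
      simp [SimpleGraph.mem_commonNeighbors, SimpleGraph.adj_comm]
    rw [h3, h2]
    simp
  -- The row sum of `N - I`, then the off-diagonal entries of `(N - I)²` where `N` is `1` and where
  -- `N` is `0`.
  refine ⟨?_, ?_, Fintype.card V, ⌊(quad α β).eval (k : ℝ) / c - 1⌋₊,
    ⌊(t + c * (a + b)) / c ^ 2 - 2⌋₊, ⌊t / c ^ 2⌋₊, rfl, ?_, ?_, ?_⟩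
  · intro hbot
    obtain ⟨u, v, huv⟩ := exists_adj hθ hm hspec
    have : (distOneOrTwoGraph G).Adj u v := Or.inl (SimpleGraph.dist_eq_one_iff_adj.2 huv)
    simp [hbot] at this
  · intro htop
    refine nearMatrix_ne_allOnes hconn hreg hθ hθ0 hm hspec h ?_
    have h1 := hM
    ext u v
    have := congrFun (congrFun h1 u) v
    rw [SimpleGraph.adjMatrix_apply, htop, Matrix.sub_apply] at this
    by_cases huv : u = v
    · simp [nearMatrix, allOnes, huv]
    · simp [huv] at this
      simp [allOnes, ← this]
  · intro u
    have h1 : ((distOneOrTwoGraph G).degree u : ℝ) = (quad α β).eval (k : ℝ) / c - 1 := by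
      rw [SimpleGraph.degree_eq_sum_if_adj]
      simp only [← nearMatrix_sub_one_apply hconn, Finset.sum_sub_distrib, hrow]
      simp [Matrix.one_apply]
    rw [← h1, Nat.floor_natCast]
  · intro u v huv
    have h1 := nearMatrix_sub_one_apply hconn u v
    rw [if_pos huv, Matrix.one_apply_ne huv.ne, sub_zero] at h1
    have h2 := hcommon u v huv.ne
    rw [h1, mul_one, mul_one] at h2
    rw [← h2, Nat.floor_natCast]
  · intro u v hne huv
    have h1 := nearMatrix_sub_one_apply hconn u v
    rw [if_neg huv, Matrix.one_apply_ne hne, sub_zero] at h1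
    have h2 := hcommon u v hne
    rw [h1, mul_zero, mul_zero, add_zero, sub_zero] at h2
    rw [← h2, Nat.floor_natCast]

end


/-! ### From distance-regular and strongly regular to equality -/

section

variable {V : Type*} [Fintype V] [DecidableEq V] {G : SimpleGraph V} [DecidableRel G.Adj]
  {k : ℕ} {θ : Fin 4 → ℝ} {m : Fin 4 → ℕ}

theorem exists_quad_eq_of_isDistanceRegular (hreg : G.IsRegularOfDegree k)
    (hdr : IsDistanceRegular G) :
    ∃ α β c : ℝ, aeval (G.adjMatrix ℝ) (quad α β) = c • nearMatrix G := by
  classical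
  obtain ⟨hconn, b, c, hbc'⟩ := hdr
  have hbc : ∀ u v,
      (Finset.univ.filter fun w => G.Adj v w ∧ G.dist u w = G.dist u v + 1).card =
        b (G.dist u v) ∧
      (Finset.univ.filter fun w => G.Adj v w ∧ G.dist u w + 1 = G.dist u v).card =
        c (G.dist u v) := fun u v => by convert hbc' u v
  -- Read off from `A² = k I + a₁ A + c₂ A₂` with `a₁ = k - b₁ - c₁`, rewritten so that `I, A, A₂`
  -- all carry the coefficient `c₂`.
  refine ⟨(k : ℝ) - b 1 - c 1 - c 2, c 2 - k, c 2, ?_⟩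
  ext u v
  have hsq : (G.adjMatrix ℝ * G.adjMatrix ℝ) u v =
      ((Finset.univ.filter fun w => G.Adj v w ∧ G.dist u w = 1).card : ℝ) := by
    rw [SimpleGraph.mul_adjMatrix_apply]
    simp only [SimpleGraph.adjMatrix_apply, Finset.sum_boole]
    congr 2
    ext w
    simp [SimpleGraph.dist_eq_one_iff_adj]
  have hentry : aeval (G.adjMatrix ℝ) (quad ((k : ℝ) - b 1 - c 1 - c 2) (c 2 - k)) u v =
      ((Finset.univ.filter fun w => G.Adj v w ∧ G.dist u w = 1).card : ℝ) -
      ((k : ℝ) - b 1 - c 1 - c 2) * (G.adjMatrix ℝ) u v +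
      (c 2 - k) * (1 : Matrix V V ℝ) u v := by
    rw [← hsq]
    rw [aeval_quad]
    rfl
  rw [hentry, Matrix.smul_apply, smul_eq_mul]
  have hdeg : (Finset.univ.filter fun w => G.Adj v w).card = k := by
    rw [← hreg.degree_eq v, ← SimpleGraph.card_neighborFinset_eq_degree]
    congr 1
    ext w
    simp
  have htri : ∀ w, G.Adj v w → G.dist u v ≤ G.dist u w + 1 ∧ G.dist u w ≤ G.dist u v + 1 := by
    intro w hw
    have h1 := hconn.dist_triangle (u := u) (v := w) (w := v)
    have h2 := hconn.dist_triangle (u := u) (v := v) (w := w)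
    rw [SimpleGraph.dist_eq_one_iff_adj.2 hw.symm] at h1
    rw [SimpleGraph.dist_eq_one_iff_adj.2 hw] at h2
    exact ⟨h1, h2⟩
  by_cases h3 : G.dist u v ≤ 2
  · obtain h | h | h : G.dist u v = 0 ∨ G.dist u v = 1 ∨ G.dist u v = 2 := by omega
    · have huv := hconn.dist_eq_zero_iff.1 h
      subst huv
      have : (Finset.univ.filter fun w => G.Adj u w ∧ G.dist u w = 1).card = k := by
        rw [← hdeg]
        congr 1
        ext w
        simp [SimpleGraph.dist_eq_one_iff_adj]
      rw [this]
      simp [nearMatrix]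
    · have hadj := SimpleGraph.dist_eq_one_iff_adj.1 h
      obtain ⟨hb, hc⟩ := hbc u v
      rw [h] at hb hc
      have hsplit : (Finset.univ.filter fun w => G.Adj v w).card =
          (Finset.univ.filter fun w => G.Adj v w ∧ G.dist u w = 1).card +
          (Finset.univ.filter fun w => G.Adj v w ∧ G.dist u w = 1 + 1).card +
          (Finset.univ.filter fun w => G.Adj v w ∧ G.dist u w + 1 = 1).card := by
        simp only [Finset.card_filter, ← Finset.sum_add_distrib]
        refine Finset.sum_congr rfl fun w _ => ?_
        by_cases hw : G.Adj v w
        · have := htri w hw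
          rw [h] at this
          have h' := this.2
          simp only [hw, true_and]
          generalize G.dist u w = i at *
          interval_cases i <;> simp
        · simp [hw]
      rw [hdeg, hb, hc] at hsplit
      have : (k : ℝ) = (Finset.univ.filter fun w => G.Adj v w ∧ G.dist u w = 1).card +
          b 1 + c 1 := by exact_mod_cast hsplit
      have hA : G.adjMatrix ℝ u v = 1 := by simp [hadj]
      have hN : nearMatrix G u v = 1 := by simp [nearMatrix, h]
      rw [hA, hN, Matrix.one_apply_ne hadj.ne]
      linarith
    · have hc := (hbc u v).2
      rw [h] at hc
      have hadj : ¬ G.Adj u v := fun h' => by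
        rw [SimpleGraph.dist_eq_one_iff_adj.2 h'] at h
        omega
      have hne : u ≠ v := fun h' => by
        rw [h'] at h
        simp at h
      have : (Finset.univ.filter fun w => G.Adj v w ∧ G.dist u w = 1).card = c 2 := by
        rw [← hc]
        congr 1
        ext w
        simp
      rw [this]
      simp [nearMatrix, h, hadj, hne]
  · have hadj : ¬ G.Adj u v := fun h' => by
      rw [SimpleGraph.dist_eq_one_iff_adj.2 h'] at h3
      omega
    have hne : u ≠ v := fun h' => by
      rw [h'] at h3
      simp at h3
    have : (Finset.univ.filter fun w => G.Adj v w ∧ G.dist u w = 1) = ∅ := by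
      ext w
      simp only [Finset.mem_filter, Finset.mem_univ, true_and, Finset.notMem_empty, iff_false,
        not_and]
      intro hw
      have := htri w hw
      omega
    rw [this]
    simp [nearMatrix, h3, hadj, hne]

/-- For `p` of degree at most `2`, `tr (p(A) N)` is the sum of all entries of `p(A)`, since `N` is
`1` on its support. -/
theorem sum_eval_mul_eval_eq (hreg : G.IsRegularOfDegree k) (hθ0 : θ 0 = k)
    (hspec : HasSpectrum G θ m) {α β c : ℝ}
    (h : aeval (G.adjMatrix ℝ) (quad α β) = c • nearMatrix G) (a b : ℝ) :
    ∑ i, (m i : ℝ) * ((quad a b).eval (θ i) * (quad α β).eval (θ i)) =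
      c * (Fintype.card V * (quad a b).eval (θ 0)) := by
  have h1 := hspec.trace_aeval G (quad a b * quad α β)
  simp only [eval_mul] at h1
  rw [← h1, map_mul, h, Matrix.mul_smul, Matrix.trace_smul, smul_eq_mul]
  congr 1
  rw [Matrix.trace, hθ0]
  calc ∑ u, (aeval (G.adjMatrix ℝ) (quad a b) * nearMatrix G).diag u
      = ∑ u : V, (quad a b).eval (k : ℝ) := by
        refine Finset.sum_congr rfl fun u _ => ?_
        rw [Matrix.diag_apply, Matrix.mul_apply, ← sum_aeval_row hreg _ u]
        refine Finset.sum_congr rfl fun v _ => ?_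
        have : nearMatrix G v u = nearMatrix G u v := by simp [nearMatrix, G.dist_comm]
        rw [this, quad_apply_mul_nearMatrix]
    _ = _ := by simp

theorem eval_zero_eq_of_quad_eq (hreg : G.IsRegularOfDegree k) (hθ0 : θ 0 = k)
    (hne : Nonempty V) (hd : ∀ u v, G.dist u v ≤ 3) {α β c : ℝ}
    (h : aeval (G.adjMatrix ℝ) (quad α β) = c • nearMatrix G) :
    (quad α β).eval (θ 0) = c * (Fintype.card V - avgAtDist G 3) := by
  have h1 : ∑ u, ∑ v, aeval (G.adjMatrix ℝ) (quad α β) u v =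
      Fintype.card V * (quad α β).eval (θ 0) := by
    simp [sum_aeval_row hreg, hθ0]
  have hn : (Fintype.card V : ℝ) ≠ 0 := by exact_mod_cast Fintype.card_ne_zero
  rw [h] at h1
  simp only [Matrix.smul_apply, smul_eq_mul, ← Finset.mul_sum] at h1
  rw [sum_nearMatrix hne hd] at h1
  refine mul_left_cancel₀ hn ?_
  linarith

omit [DecidableEq V] [DecidableRel G.Adj] in
theorem avgAtDist_three_pos {u v : V} (h : G.dist u v = 3) : 0 < avgAtDist G 3 := by
  classical
  have : Nonempty V := ⟨u⟩
  refine mul_pos (one_div_pos.2 (by exact_mod_cast Fintype.card_pos)) ?_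
  refine Finset.sum_pos' (fun _ _ => by positivity) ⟨u, Finset.mem_univ u, ?_⟩
  have : 0 < numAtDist G 3 u := Finset.card_pos.2 ⟨v, by simp [h]⟩
  exact_mod_cast this

/-- The numbers `q(θᵢ)/c` are eigenvalues of `N`. Pairing `q` with the quadratic that vanishes at
two of `θ₁, θ₂, θ₃` isolates the third and shows their signs to be `+, -, +`. Strong regularity
makes the three values `q(θᵢ)` roots of one quadratic, so `q(θ₁) = q(θ₃)`. -/
theorem eq_add_of_isStronglyRegular (hconn : G.Connected)
    (hreg : G.IsRegularOfDegree k) (hθ : StrictAnti θ) (hθ0 : θ 0 = k) (hm : ∀ i, 0 < m i)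
    (hm0 : m 0 = 1) (hspec : HasSpectrum G θ m) {α β c : ℝ}
    (h : aeval (G.adjMatrix ℝ) (quad α β) = c • nearMatrix G)
    (hsrg : IsStronglyRegular (distOneOrTwoGraph G)) : α = θ 1 + θ 3 := by
  classical
  have hc := ne_zero_of_quad_eq_smul_nearMatrix hθ hm hspec h
  have hd := dist_le_three hconn hreg hθ hθ0 hm hspec
  have hne := hconn.nonempty
  obtain ⟨-, htop, n', k', l', μ', hs⟩ := hsrg
  -- Since `Γ₁,₂` is not complete, some pair is at distance `3`; this makes `k̄₃ > 0`, hence the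
  -- signs below strict.
  obtain ⟨u, v, huv⟩ : ∃ u v, G.dist u v = 3 := by
    by_contra! hno
    refine htop ?_
    ext u v
    simp only [SimpleGraph.top_adj]
    refine ⟨fun h' => h'.ne, fun h' => ?_⟩
    have h0 : G.dist u v ≠ 0 := fun h => h' (hconn.dist_eq_zero_iff.1 h)
    have := hno u v
    have := hd u v
    simp only [distOneOrTwoGraph]
    omega
  have hx := avgAtDist_three_pos huv
  have hA : (distOneOrTwoGraph G).adjMatrix ℝ = nearMatrix G - 1 := by
    ext u v
    rw [SimpleGraph.adjMatrix_apply, Matrix.sub_apply, nearMatrix_sub_one_apply hconn]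
  have hAc : (distOneOrTwoGraph G)ᶜ.adjMatrix ℝ = allOnes V - nearMatrix G := by
    ext u v
    have h1 := congrFun (congrFun hA u) v
    by_cases huv : u = v
    · subst huv
      simp [nearMatrix, allOnes]
    · rw [SimpleGraph.adjMatrix_apply, Matrix.sub_apply, Matrix.one_apply_ne huv, sub_zero] at h1
      rw [SimpleGraph.adjMatrix_apply, Matrix.sub_apply, ← h1]
      by_cases h2 : (distOneOrTwoGraph G).Adj u v <;> simp [huv, h2, allOnes]
  have hM := hs.matrix_eq (α := ℝ)
  rw [hA, hAc] at hM
  obtain ⟨x, y, hxy⟩ : ∃ x y : ℝ, nearMatrix G * nearMatrix G =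
      x • (1 : Matrix V V ℝ) + y • nearMatrix G + (μ' : ℝ) • allOnes V := by
    -- Obtained by expanding `(N - I)² = k' I + l' (N - I) + μ' (J - N)`.
    refine ⟨(k' : ℝ) - l' - 1, (l' : ℝ) - μ' + 2, ?_⟩
    have : (nearMatrix G - 1) ^ 2 = nearMatrix G * nearMatrix G - (2 : ℝ) • nearMatrix G + 1 := by
      rw [two_smul]
      noncomm_ring
    rw [this] at hM
    simp only [← Nat.cast_smul_eq_nsmul ℝ] at hM
    ext u v
    have := congrFun (congrFun hM u) v
    simp only [Matrix.add_apply, Matrix.sub_apply, Matrix.smul_apply, smul_eq_mul] at this ⊢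
    linarith
  have hF : aeval (G.adjMatrix ℝ) (quad α β * quad α β - C (c * y) * quad α β - C (c ^ 2 * x)) =
      (c ^ 2 * μ') • allOnes V := by
    simp only [map_sub, map_mul (aeval (G.adjMatrix ℝ)), h, aeval_C,
      Algebra.algebraMap_eq_smul_one, Matrix.smul_mul, Matrix.mul_smul, Matrix.one_mul, hxy]
    ext u v
    simp only [Matrix.add_apply, Matrix.sub_apply, Matrix.smul_apply, smul_eq_mul]
    ring
  obtain ⟨f1, f2, f3⟩ :=
    eval_eq_zero_of_aeval_eq_smul_allOnes hconn hreg hθ hθ0 hm hspec hF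
  simp only [eval_sub, eval_mul, eval_C] at f1 f2 f3
  have hq0 := eval_zero_eq_of_quad_eq hreg hθ0 hne hd h
  have key : ∀ a b, ∑ i ∈ {1, 2, 3}, (m i : ℝ) * ((quad a b).eval (θ i) *
      ((quad α β).eval (θ i) / c)) = avgAtDist G 3 * (quad a b).eval (θ 0) := by
    intro a b
    have h1 := sum_eval_mul_eval_eq hreg hθ0 hspec h a b
    rw [sum_eq_zero_term_add (f := fun i => (quad a b).eval (θ i) * (quad α β).eval (θ i)) hm0,
      hq0] at h1
    simp only [← mul_div_assoc]
    rw [← Finset.sum_div, div_eq_iff hc]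
    linarith
  have h01 : θ 1 < θ 0 := hθ (by decide)
  have h12 : θ 2 < θ 1 := hθ (by decide)
  have h23 : θ 3 < θ 2 := hθ (by decide)
  have hm' : ∀ i, (0 : ℝ) < m i := fun i => by exact_mod_cast hm i
  have hroots : ∀ a b x, (quad (a + b) (a * b)).eval x = (x - a) * (x - b) := by
    intro a b x
    rw [eval_quad]
    ring
  have s1 := key (θ 2 + θ 3) (θ 2 * θ 3)
  have s2 := key (θ 1 + θ 3) (θ 1 * θ 3)
  have s3 := key (θ 1 + θ 2) (θ 1 * θ 2)
  have hsum : ∀ g : Fin 4 → ℝ, ∑ i ∈ {1, 2, 3}, g i = g 1 + g 2 + g 3 := by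
    intro g
    simp [add_assoc]
  simp only [hroots, hsum, sub_self, zero_mul, mul_zero, add_zero, zero_add] at s1 s2 s3
  have p1 : 0 < (quad α β).eval (θ 1) / c := by
    refine pos_of_mul_pos_right (a := m 1 * ((θ 1 - θ 2) * (θ 1 - θ 3))) ?_ ?_
    · rw [mul_assoc, s1]
      exact mul_pos hx (mul_pos (by linarith) (by linarith))
    · exact (mul_pos (hm' 1) (mul_pos (by linarith) (by linarith))).le
  have p2 : (quad α β).eval (θ 2) / c < 0 := by
    refine neg_pos.1 (pos_of_mul_pos_right (a := m 2 * ((θ 1 - θ 2) * (θ 2 - θ 3))) ?_ ?_)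
    · have : m 2 * ((θ 1 - θ 2) * (θ 2 - θ 3)) * -((quad α β).eval (θ 2) / c) =
        m 2 * ((θ 2 - θ 1) * (θ 2 - θ 3) * ((quad α β).eval (θ 2) / c)) := by ring
      rw [this, s2]
      exact mul_pos hx (mul_pos (by linarith) (by linarith))
    · exact (mul_pos (hm' 2) (mul_pos (by linarith) (by linarith))).le
  have p3 : 0 < (quad α β).eval (θ 3) / c := by
    refine pos_of_mul_pos_right (a := m 3 * ((θ 1 - θ 3) * (θ 2 - θ 3))) ?_ ?_
    · have : m 3 * ((θ 1 - θ 3) * (θ 2 - θ 3)) * ((quad α β).eval (θ 3) / c) =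
        m 3 * ((θ 3 - θ 1) * (θ 3 - θ 2) * ((quad α β).eval (θ 3) / c)) := by ring
      rw [this, s3]
      exact mul_pos hx (mul_pos (by linarith) (by linarith))
    · exact (mul_pos (hm' 3) (mul_pos (by linarith) (by linarith))).le
  have n12 : (quad α β).eval (θ 1) - (quad α β).eval (θ 2) ≠ 0 := fun h' => by
    rw [sub_eq_zero.1 h'] at p1
    linarith
  have n32 : (quad α β).eval (θ 3) - (quad α β).eval (θ 2) ≠ 0 := fun h' => by
    rw [sub_eq_zero.1 h'] at p3
    linarith
  -- Distinct roots of `t² - c y t - c² x` sum to `c y`; the signs separate `θ₂` from the other two.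
  have t1 : (quad α β).eval (θ 1) + (quad α β).eval (θ 2) = c * y :=
    mul_left_cancel₀ n12 (by linarith)
  have t3 : (quad α β).eval (θ 3) + (quad α β).eval (θ 2) = c * y :=
    mul_left_cancel₀ n32 (by linarith)
  have t13 : (quad α β).eval (θ 1) = (quad α β).eval (θ 3) := by linarith
  rw [eval_quad, eval_quad] at t13
  have : (θ 1 - θ 3) * (θ 1 + θ 3 - α) = 0 := by linarith
  rcases mul_eq_zero.1 this with h' | h' <;> linarith

/-- Adding `δ` to the quadratic leaves the denominator of `τ` unchanged and adds `δ` to `τ`. For `q`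
itself `τ = 0`: from `q(A) = c N`, both `∑ mᵢ q(θᵢ)²` and `q(θ₀) ∑ mᵢ q(θᵢ)` equal `c n q(θ₀)`. -/
theorem tau_eq_of_quad_eq (hreg : G.IsRegularOfDegree k) (hθ0 : θ 0 = k)
    (hm0 : m 0 = 1) (hspec : HasSpectrum G θ m) {α β c : ℝ}
    (h : aeval (G.adjMatrix ℝ) (quad α β) = c • nearMatrix G) (β' : ℝ)
    (hden : tauDen θ m (Fintype.card V) (quad α β') ≠ 0) :
    tau θ m (Fintype.card V) (quad α β') = β' - β := by
  have e1 := sum_eval_mul_eval_eq hreg hθ0 hspec h α β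
  rw [sum_eq_zero_term_add (f := fun i => (quad α β).eval (θ i) * (quad α β).eval (θ i)) hm0]
    at e1
  have e2 := hspec.trace_aeval G (quad α β)
  rw [sum_eq_zero_term_add (f := fun i => (quad α β).eval (θ i)) hm0, h, Matrix.trace_smul] at e2
  have e3 : (nearMatrix G).trace = Fintype.card V := by
    simp [Matrix.trace, nearMatrix]
  have e4 := hspec.trace_aeval G 1
  rw [sum_eq_zero_term_add (f := fun i => (1 : ℝ[X]).eval (θ i)) hm0] at e4
  rw [e3] at e2
  simp only [map_one, Matrix.trace_one, eval_one] at e4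
  rw [tau, div_eq_iff hden, tauDen]
  have hshift : ∀ x, (quad α β').eval x = (quad α β).eval x + (β' - β) := by
    intro x
    rw [eval_quad, eval_quad]
    ring
  simp only [hshift]
  simp only [Finset.mem_insert, Finset.mem_singleton, Fin.reduceEq, or_self, not_false_eq_true,
    Finset.sum_insert, Finset.sum_singleton, smul_eq_mul] at e1 e2 e4 ⊢
  linear_combination -e1 - (quad α β).eval (θ 0) * e2 -
    ((quad α β).eval (θ 0) * (β' - β) + (β' - β) ^ 2) * e4

theorem tauDen_quad (hreg : G.IsRegularOfDegree k) (hθ0 : θ 0 = k)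
    (hm0 : m 0 = 1) (hspec : HasSpectrum G θ m) (α β : ℝ) :
    tauDen θ m (Fintype.card V) (quad α β) =
      Fintype.card V * (k * (k - 1 - α)) := by
  have e := hspec.trace_aeval G (quad α β)
  rw [sum_eq_zero_term_add (f := fun i => (quad α β).eval (θ i)) hm0] at e
  have ht : (aeval (G.adjMatrix ℝ) (quad α β)).trace = Fintype.card V * (k + β) := by
    rw [aeval_quad, Matrix.trace_add, Matrix.trace_sub, Matrix.trace_smul, Matrix.trace_smul,
      SimpleGraph.trace_adjMatrix, Matrix.trace_one]
    simp only [Matrix.trace, Matrix.diag_apply, SimpleGraph.adjMatrix_mul_self_apply_self,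
      hreg.degree_eq]
    simp
    ring
  rw [ht] at e
  rw [tauDen]
  rw [eval_quad, hθ0] at *
  linarith

theorem spectralBound_quad (n : ℕ) (α β : ℝ) :
    spectralBound θ m n (quad α β) =
      (n * ∑ i ∈ {1, 2, 3}, (m i : ℝ) *
        (quad α (β - tau θ m n (quad α β))).eval (θ i) ^ 2) /
        ∑ i, (m i : ℝ) * (quad α (β - tau θ m n (quad α β))).eval (θ i) ^ 2 := by
  have : ∀ x, (quad α (β - tau θ m n (quad α β))).eval x =
      (quad α β).eval x - tau θ m n (quad α β) := by
    intro x
    rw [eval_quad, eval_quad]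
    ring
  simp only [this, spectralBound]

end

end SpectralExcess

/-! ### The main theorem -/

open SpectralExcess in
theorem mainTheorem2 {V : Type*} [Fintype V] [DecidableEq V] (G : SimpleGraph V)
    [DecidableRel G.Adj] (k : ℕ) (θ : Fin 4 → ℝ) (m : Fin 4 → ℕ)
    (hconn : G.Connected) (hreg : G.IsRegularOfDegree k)
    (hθ : StrictAnti θ) (hθ0 : θ 0 = k) (hm : ∀ i, 0 < m i) (hm0 : m 0 = 1)
    (hspec : HasSpectrum G θ m)
    (n : ℕ) (hn : n = Fintype.card V)
    (γ₂ : ℝ) (hγ₂ : γ₂ = preGammaSucc G k 1)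
    (s : Fin 2 → ℝ[X]) (hs : s = ![s₁ θ γ₂, s₂ θ γ₂]) :
    tauDen θ m n (s 0) ≠ 0 ∧
    (∀ j, tauDen θ m n (s j) ≠ 0 → avgAtDist G 3 ≤ spectralBound θ m n (s j)) ∧
    ((∃ j, tauDen θ m n (s j) ≠ 0 ∧ avgAtDist G 3 = spectralBound θ m n (s j)) ↔
      IsDistanceRegular G ∧ IsStronglyRegular (distOneOrTwoGraph G)) := by
  have hs0 : s 0 = quad (θ 1 + θ 3) (γ₂ + θ 2 * (θ 1 - θ 2 + θ 3)) := by
    rw [hs]; rfl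
  have hs1 : s 1 = quad (θ 1 + θ 2) (γ₂ + θ 3 * (θ 1 - θ 3 + θ 2)) := by
    rw [hs]; rfl
  have hsj : ∀ j, ∃ α β, s j = quad α β ∧ (α = θ 1 + θ 3 ∨ α = θ 1 + θ 2) := by
    intro j
    fin_cases j
    · exact ⟨_, _, hs0, Or.inl rfl⟩
    · exact ⟨_, _, hs1, Or.inr rfl⟩
  subst hn
  have hne := hconn.nonempty
  have hd := dist_le_three hconn hreg hθ hθ0 hm hspec
  have hden : tauDen θ m (Fintype.card V) (s 0) ≠ 0 := by
    rw [hs0, tauDen_quad hreg hθ0 hm0 hspec]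
    have hk : (k : ℝ) ≠ 0 := by
      obtain ⟨u, v, huv⟩ := exists_adj hθ hm hspec
      have := (G.degree_pos_iff_exists_adj u).2 ⟨v, huv⟩
      rw [hreg.degree_eq] at this
      exact_mod_cast this.ne'
    have hcard : (Fintype.card V : ℝ) ≠ 0 := by exact_mod_cast Fintype.card_ne_zero
    -- Together with `θ₁ < k` this gives `θ₁ + θ₃ < k - 1`, so the factor `k - 1 - α` is positive.
    have h3 := smallest_eigenvalue_le_neg_one hθ hm hspec
    have h1 : θ 1 < θ 0 := hθ (by decide)
    refine mul_ne_zero hcard (mul_ne_zero hk ?_)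
    linarith
  have hbound := avgAtDist_le_and_eq_iff hreg hθ hθ0 hm hm0 hspec hne hd
  refine ⟨hden, ?_, ?_, ?_⟩
  · intro j _
    obtain ⟨α, β, hj, -⟩ := hsj j
    rw [hj, spectralBound_quad]
    exact (hbound _ _).1
  · rintro ⟨j, -, heq⟩
    obtain ⟨α, β, hj, hα⟩ := hsj j
    rw [hj, spectralBound_quad] at heq
    obtain ⟨c, hc⟩ := (hbound _ _).2.1 heq
    refine ⟨isDistanceRegular_of_quad_eq hconn hreg hθ hθ0 hm hspec hc, ?_⟩
    set β' := β - tau θ m (Fintype.card V) (quad α β)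
    -- A quadratic is symmetric about `α/2`, so its value at `θ₁` repeats the one at `θ₃` or at
    -- `θ₂`, according to `α`.
    refine isStronglyRegular_of_quad_eq hconn hreg hθ hθ0 hm hspec hc
      (a := (quad α β').eval (θ 2)) (b := (quad α β').eval (θ 3)) fun i hi => ?_
    rw [mul_eq_zero, sub_eq_zero, sub_eq_zero]
    fin_cases i
    · exact absurd rfl hi
    · rcases hα with rfl | rfl
      · right
        simp only [eval_quad, Fin.mk_one]
        ring
      · left
        simp only [eval_quad, Fin.mk_one]
        ring
    · exact Or.inl rfl
    · exact Or.inr rfl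
  · rintro ⟨hdr, hsrg⟩
    obtain ⟨α, β, c, hc⟩ := exists_quad_eq_of_isDistanceRegular hreg hdr
    obtain rfl := eq_add_of_isStronglyRegular hconn hreg hθ hθ0 hm hm0 hspec hc hsrg
    -- Index `0` is `s₁`, whose linear coefficient matches; subtracting `τ` turns its constant term
    -- into `β`.
    refine ⟨0, hden, ?_⟩
    rw [hs0] at hden ⊢
    rw [spectralBound_quad, tau_eq_of_quad_eq hreg hθ0 hm0 hspec hc _ hden, sub_sub_cancel]
    exact (hbound _ _).2.2 ⟨c, hc⟩
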